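/- Let $A\in\mathbb R^{n_x\times n_x}$ and $B\in\mathbb R^{n_x\times n_u}$ with $\operatorname{rank}(B)=n_u\le n_x$, and let $\mathbb X\subseteq\mathbb R^{n_x}$ and $\mathbb U\subseteq\mathbb R^{n_u}$ be closed convex sets with $0\in\mathbb X$ and $0\in\mathbb U$. Let $L:\mathbb R^{n_x}\times\mathbb R^{n_u}\to\mathbb R$ be convex and positive definite, that is, $L(0,0)=0$ and $L(x,u)>0$ for all $(x,u)\neq(0,0)$. Let $0\le\lambda<1$ and let $X\subseteq\mathbb X$ be a compact convex $\lambda$-control invariant set with $0\in X$, that is, for every $x\in X$ there is $u\in\mathbb U$ with $Ax+Bu\in\lambda X$. For a set $S$, let $I_S$ be equal to $0$ on $S$ and to $+\infty$ off $S$. A function $M:\mathbb R^{n_x}\to\mathbb R\cup\{\infty\}$ is called an $L$-CLF if $M(0)=0$ and $M(x)>0$ for all $x\ne0$, if its domain $\operatorname{dom}(M)=\{x: M(x)<\infty\}$ is non-empty and compact and its epigraph is a closed convex set, and if \[ M(x)\ \ge\ \min_{u\in\mathbb U}\ L(x,u)+I_{\mathbb X}(x)+M(Ax+Bu)\qquad\text{for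 all } x\in\mathbb R^{n_x}, \] where the minimum is attained. Let $\mathcal M(X)$ be the set of all $L$-CLFs $M$ with $\operatorname{dom}(M)=X$. Let $\mu$ be any Borel probability measure on $X$ with full support, $\operatorname{supp}(\mu)=X$. Then the problem \[ \min_{M\in\mathcal M(X)}\ \int_X M\,\mathrm d\mu \] (with objective values in $[0,\infty]$) has a minimizer $M^\star\in\mathcal M(X)$, the minimum value is finite, and the minimizer is unique. Moreover, $M^\star$ is the infinite-horizon cost: for every $x_0\in\mathbb R^{n_x}$, \[ M^\star(x_0)=\inf\Big\{\sum_{k=0}^\infty L(x_k,u_k)\ :\ x_{k+1}=Ax_k+Bu_k,\ x_k\in X,\ u_k\in\mathbb U\ \text{for all } k\ge 0\Big\}, \] where the infimum of the empty set is $+\infty$; and $M^\star$ satisfies the discrete-time HJB equation on $X$: for all $x\in X$, \[ M^\star(x)\ =\ \min_{u\in\mathbb U}\ L(x,u)+I_X(x)+M^\star(Ax+Bu), \] where the minimum is attained. -/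

import Mathlib

open MeasureTheory
open scoped ENNReal Pointwise Matrix

/-- Positive definiteness of a (possibly extended-valued) function: it vanishes at the origin and
is positive everywhere else. -/
def PosDefFun {E R : Type*} [Zero E] [Zero R] [LT R] (f : E → R) : Prop :=
  f 0 = 0 ∧ ∀ x, x ≠ 0 → 0 < f x

/-- The effective domain of an extended-valued function. -/
def effDom {E : Type*} (M : E → EReal) : Set E :=
  {x | M x < ⊤}

/-- The epigraph of an extended-valued function. -/
def epigraph {E : Type*} (M : E → EReal) : Set (E × ℝ) :=
  {p | M p.1 ≤ (p.2 : EReal)}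

/-- Proper compact convex functions with values in `ℝ ∪ {∞}`. -/
structure IsProperCompactConvex {n : ℕ} (M : (Fin n → ℝ) → EReal) : Prop where
  ne_bot : ∀ x, M x ≠ ⊥
  dom_nonempty : (effDom M).Nonempty
  dom_compact : IsCompact (effDom M)
  epi_closed : IsClosed (epigraph M)
  epi_convex : Convex ℝ (epigraph M)

open Classical in
/-- The convex-analysis indicator function: `0` on `S` and `∞` off `S`. -/
noncomputable def convIndicator {E : Type*} (S : Set E) (x : E) : EReal :=
  if x ∈ S then 0 else ⊤

/-- Standing assumptions on the constrained system `x⁺ = A x + B u`, `x ∈ XX`, `u ∈ UU`. -/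
structure SystemAssumption {nx nu : ℕ} (B : Matrix (Fin nx) (Fin nu) ℝ)
    (XX : Set (Fin nx → ℝ)) (UU : Set (Fin nu → ℝ)) : Prop where
  state_closed : IsClosed XX
  state_convex : Convex ℝ XX
  state_zero : (0 : Fin nx → ℝ) ∈ XX
  control_closed : IsClosed UU
  control_convex : Convex ℝ UU
  control_zero : (0 : Fin nu → ℝ) ∈ UU
  rank_eq : B.rank = nu

/-- Standing assumptions on the stage cost. -/
structure StageCostAssumption {nx nu : ℕ} (L : (Fin nx → ℝ) × (Fin nu → ℝ) → ℝ) : Prop where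
  convex : ConvexOn ℝ Set.univ L
  nonneg : ∀ p, 0 ≤ L p
  zero : L (0, 0) = 0

/-- `X` is a (compact, convex) `lam`-control invariant set containing the origin. -/
structure IsControlInvariant {nx nu : ℕ} (A : Matrix (Fin nx) (Fin nx) ℝ)
    (B : Matrix (Fin nx) (Fin nu) ℝ) (XX : Set (Fin nx → ℝ)) (UU : Set (Fin nu → ℝ))
    (lam : ℝ) (X : Set (Fin nx → ℝ)) : Prop where
  subset_state : X ⊆ XX
  compact : IsCompact X
  convex : Convex ℝ X
  zero_mem : (0 : Fin nx → ℝ) ∈ X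
  contractive : ∀ x ∈ X, ∃ u ∈ UU, A *ᵥ x + B *ᵥ u ∈ lam • X

/-- The function `u ↦ L(x, u) + I_S(x) + M(A x + B u)` that is minimized over the controls. -/
noncomputable def bellmanTerm {nx nu : ℕ} (A : Matrix (Fin nx) (Fin nx) ℝ)
    (B : Matrix (Fin nx) (Fin nu) ℝ) (S : Set (Fin nx → ℝ))
    (L : (Fin nx → ℝ) × (Fin nu → ℝ) → ℝ) (M : (Fin nx → ℝ) → EReal)
    (x : Fin nx → ℝ) (u : Fin nu → ℝ) : EReal :=
  (L (x, u) : EReal) + convIndicator S x + M (A *ᵥ x + B *ᵥ u)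

/-- `M` is an `L`-CLF: positive definite, proper compact convex, and satisfying the control
Lyapunov inequality, in which the minimum over the controls is attained. -/
structure IsCLF {nx nu : ℕ} (A : Matrix (Fin nx) (Fin nx) ℝ)
    (B : Matrix (Fin nx) (Fin nu) ℝ) (XX : Set (Fin nx → ℝ)) (UU : Set (Fin nu → ℝ))
    (L : (Fin nx → ℝ) × (Fin nu → ℝ) → ℝ) (M : (Fin nx → ℝ) → EReal) : Prop where
  posDef : PosDefFun M
  properCompactConvex : IsProperCompactConvex M
  lyapunov : ∀ x, ∃ m, IsLeast (bellmanTerm A B XX L M x '' UU) m ∧ m ≤ M x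

/-- The set of all `L`-CLFs whose domain is `X`. -/
def clfSet {nx nu : ℕ} (A : Matrix (Fin nx) (Fin nx) ℝ)
    (B : Matrix (Fin nx) (Fin nu) ℝ) (XX : Set (Fin nx → ℝ)) (UU : Set (Fin nu → ℝ))
    (L : (Fin nx → ℝ) × (Fin nu → ℝ) → ℝ) (X : Set (Fin nx → ℝ)) :
    Set ((Fin nx → ℝ) → EReal) :=
  {M | IsCLF A B XX UU L M ∧ effDom M = X}

/-- The objective `∫_X M dμ`, with values in `[0, ∞]`. (It is only used for nonnegative `M`, for
which `EReal.toENNReal` loses nothing.) -/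
noncomputable def clfObjective {n : ℕ} (X : Set (Fin n → ℝ)) (μ : Measure (Fin n → ℝ))
    (M : (Fin n → ℝ) → EReal) : ℝ≥0∞ :=
  ∫⁻ x in X, (M x).toENNReal ∂μ

/-- The discrete-time HJB equation on `X`, with `X` as state constraint set:
`M(x) = min_{u ∈ UU} L(x, u) + I_X(x) + M(A x + B u)` for all `x ∈ X`. -/
def SatisfiesHJB {nx nu : ℕ} (A : Matrix (Fin nx) (Fin nx) ℝ)
    (B : Matrix (Fin nx) (Fin nu) ℝ) (UU : Set (Fin nu → ℝ))
    (L : (Fin nx → ℝ) × (Fin nu → ℝ) → ℝ) (X : Set (Fin nx → ℝ))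
    (M : (Fin nx → ℝ) → EReal) : Prop :=
  ∀ x ∈ X, IsLeast (bellmanTerm A B X L M x '' UU) (M x)

/-- Admissible infinite state and control trajectories starting at `x₀`, with states in `X`. -/
structure IsTrajectory {nx nu : ℕ} (A : Matrix (Fin nx) (Fin nx) ℝ)
    (B : Matrix (Fin nx) (Fin nu) ℝ) (UU : Set (Fin nu → ℝ)) (X : Set (Fin nx → ℝ))
    (x₀ : Fin nx → ℝ) (x : ℕ → Fin nx → ℝ) (u : ℕ → Fin nu → ℝ) : Prop where
  init : x 0 = x₀
  step : ∀ k, x (k + 1) = A *ᵥ x k + B *ᵥ u k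
  state_mem : ∀ k, x k ∈ X
  control_mem : ∀ k, u k ∈ UU

/-- The infinite-horizon cost `inf ∑_k L(x_k, u_k)` over the admissible trajectories starting at
`x₀` (equal to `∞` if there are none, in particular for `x₀ ∉ X`). -/
noncomputable def infiniteHorizonCost {nx nu : ℕ} (A : Matrix (Fin nx) (Fin nx) ℝ)
    (B : Matrix (Fin nx) (Fin nu) ℝ) (UU : Set (Fin nu → ℝ))
    (L : (Fin nx → ℝ) × (Fin nu → ℝ) → ℝ) (X : Set (Fin nx → ℝ))
    (x₀ : Fin nx → ℝ) : ℝ≥0∞ :=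
  ⨅ (x : ℕ → Fin nx → ℝ) (u : ℕ → Fin nu → ℝ) (_ : IsTrajectory A B UU X x₀ x u),
    ∑' k, ENNReal.ofReal (L (x k, u k))

/-! Write `V` for the infinite-horizon cost. Iterating the Lyapunov inequality of a CLF `M` along
minimizing controls produces an admissible trajectory of total cost at most `M x`, so `V ≤ M`
pointwise (`infiniteHorizonCost_le_of_mem_clfSet`). Conversely `V` is itself a CLF with domain `X`
(`infiniteHorizonCost_mem_clfSet`): full column rank of `B` makes the trajectory set compact, which
gives attainment and lower semicontinuity; contractivity bounds `V` on `X` by a geometric series;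
linearity of the dynamics gives convexity. Hence `V` minimizes the integral.

Uniqueness: another minimizer `M` satisfies `M ≥ V` with equal finite integrals, so `M = V` on a set
dense in `X`, by full support. Since `X` may have empty interior and neither function need be
continuous on its relative boundary, the equality is extended by convexity of `V` and closedness of
the epigraph of `M` (`graph_mem_of_dense`, `le_of_clfObjective_le`). -/

open Filter Topology

/-- If the graph of a convex function over a dense part of its convex domain lies in a closed set
that is upward closed in the second coordinate, then the whole graph lies in that set. -/
lemma graph_mem_of_dense {E : Type*} [NormedAddCommGroup E] [NormedSpace ℝ E]
    [FiniteDimensional ℝ E] {X D : Set E} {f : E → ℝ} {C : Set (E × ℝ)}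
    (h0 : (0 : E) ∈ X) (hf : ConvexOn ℝ X f) (hC : IsClosed C)
    (hup : ∀ x r s, (x, r) ∈ C → r ≤ s → (x, s) ∈ C)
    (hDX : D ⊆ X) (hXD : X ⊆ closure D) (hD : ∀ d ∈ D, (d, f d) ∈ C) :
    ∀ x ∈ X, (x, f x) ∈ C := by
  -- `X` can be lower-dimensional in `E`; in its span it has interior points, because `0 ∈ X` makes
  -- the affine hull equal to the span.
  set W : Submodule ℝ E := Submodule.span ℝ X with hW
  have hXW : ∀ x ∈ X, x ∈ W := fun x hx => Submodule.subset_span hx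
  set X' : Set W := ((↑) : W → E) ⁻¹' X with hX'
  have hf' : ConvexOn ℝ X' (fun w : W => f w) := hf.comp_linearMap W.subtype
  have hint : (interior X').Nonempty := by
    rw [hf'.1.interior_nonempty_iff_affineSpan_eq_top]
    have h0' : (0 : W) ∈ X' := by simpa [hX'] using h0
    have hspan : Submodule.span ℝ X' = ⊤ := Submodule.span_span_coe_preimage
    apply SetLike.coe_injective
    rw [← Set.insert_eq_of_mem h0', affineSpan_insert_zero, hspan]
    rfl
  have hgood : ∀ y ∈ interior X', ((y : E), f y) ∈ C := by
    intro y hy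
    have hcont : ContinuousAt (fun w : W => ((w : E), f w)) y := by
      refine ContinuousAt.prodMk continuous_subtype_val.continuousAt ?_
      exact ((hf'.subset interior_subset hf'.1.interior).continuousOn isOpen_interior).continuousAt
        (isOpen_interior.mem_nhds hy)
    have hcl : y ∈ closure (((↑) : W → E) ⁻¹' D) := by
      rw [IsInducing.subtypeVal.closure_eq_preimage_closure_image]
      have hsub : D ⊆ ((↑) : W → E) '' (((↑) : W → E) ⁻¹' D) :=
        fun d hd => ⟨⟨d, hXW d (hDX hd)⟩, hd, rfl⟩
      exact closure_mono hsub (hXD (interior_subset hy : y ∈ X'))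
    exact hC.mem_of_frequently_of_tendsto
      ((mem_closure_iff_frequently.1 hcl).mono fun w hw => hD w hw) hcont
  obtain ⟨z, hz⟩ := hint
  intro x hx
  -- Boundary points are approached along a segment from an interior point `z`: convexity bounds `f`
  -- by the chord, so the chord point lies in `C`, and `C` is closed.
  have hlim : Tendsto (fun t : ℝ => ((1 - t) • x + t • (z : E), (1 - t) * f x + t * f z))
      (𝓝[>] 0) (𝓝 (x, f x)) := by
    have : Continuous (fun t : ℝ => ((1 - t) • x + t • (z : E), (1 - t) * f x + t * f z)) := by
      fun_prop
    simpa using (this.tendsto 0).mono_left nhdsWithin_le_nhds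
  refine hC.mem_of_tendsto hlim ?_
  filter_upwards [Ioo_mem_nhdsGT (zero_lt_one' ℝ)] with t ht
  have hy : (1 - t) • (⟨x, hXW x hx⟩ : W) + t • z ∈ interior X' :=
    hf'.1.combo_self_interior_mem_interior hx hz (by linarith [ht.2]) ht.1 (by ring)
  exact hup _ _ _ (hgood _ hy)
    (hf.2 hx (interior_subset hz : z ∈ X') (by linarith [ht.2]) ht.1.le (by ring))

/-! ### Compactness of trajectories; regularity, convexity and boundedness of the infinite-horizon
cost. -/

section Trajectories

variable {nx nu : ℕ} {A : Matrix (Fin nx) (Fin nx) ℝ} {B : Matrix (Fin nx) (Fin nu) ℝ}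
  {XX : Set (Fin nx → ℝ)} {UU : Set (Fin nu → ℝ)} {L : (Fin nx → ℝ) × (Fin nu → ℝ) → ℝ}
  {lam : ℝ} {X : Set (Fin nx → ℝ)}

/-- Controls that admissibly steer some state of `X` into `X`. -/
def steeringControls (A : Matrix (Fin nx) (Fin nx) ℝ) (B : Matrix (Fin nx) (Fin nu) ℝ)
    (X : Set (Fin nx → ℝ)) : Set (Fin nu → ℝ) :=
  {u | ∃ x ∈ X, A *ᵥ x + B *ᵥ u ∈ X}

/-- Rank-nullity makes `B` injective. This is what bounds controls in terms of states, `UU` itself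
being possibly unbounded. -/
lemma isClosedEmbedding_mulVec_of_rank_eq (hB : B.rank = nu) :
    IsClosedEmbedding (fun u => B *ᵥ u) := by
  have hker : LinearMap.ker B.mulVecLin = ⊥ := by
    rw [← Submodule.finrank_eq_zero (R := ℝ)]
    have := B.mulVecLin.finrank_range_add_finrank_ker
    rw [← Matrix.rank, hB] at this
    simpa using this
  exact LinearMap.isClosedEmbedding_of_injective hker

lemma isCompact_steeringControls (hB : B.rank = nu) (hX : IsCompact X) :
    IsCompact (steeringControls A B X) := by
  have hcomp : IsCompact ((fun p : (Fin nx → ℝ) × (Fin nx → ℝ) => p.1 - A *ᵥ p.2) '' (X ×ˢ X)) :=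
    (hX.prod hX).image (by fun_prop)
  convert (isClosedEmbedding_mulVec_of_rank_eq hB).isCompact_preimage hcomp using 1
  ext u
  simp only [steeringControls, Set.mem_ofPred_eq, Set.mem_preimage, Set.mem_image, Set.mem_prod,
    Prod.exists]
  constructor
  · rintro ⟨x, hx, h⟩
    exact ⟨_, x, ⟨h, hx⟩, by simp⟩
  · rintro ⟨y, x, ⟨hy, hx⟩, h⟩
    refine ⟨x, hx, ?_⟩
    rw [← h]
    simpa using hy

/-- The set of all admissible trajectories. -/
def trajectorySet (A : Matrix (Fin nx) (Fin nx) ℝ) (B : Matrix (Fin nx) (Fin nu) ℝ)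
    (UU : Set (Fin nu → ℝ)) (X : Set (Fin nx → ℝ)) :
    Set ((ℕ → Fin nx → ℝ) × (ℕ → Fin nu → ℝ)) :=
  {p | IsTrajectory A B UU X (p.1 0) p.1 p.2}

/-- The accumulated cost of a trajectory. -/
noncomputable def trajectoryCost (L : (Fin nx → ℝ) × (Fin nu → ℝ) → ℝ)
    (p : (ℕ → Fin nx → ℝ) × (ℕ → Fin nu → ℝ)) : ℝ≥0∞ :=
  ∑' k, ENNReal.ofReal (L (p.1 k, p.2 k))

/-- Tychonoff: each constraint is closed and involves finitely many coordinates. -/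
lemma isCompact_trajectorySet (hB : B.rank = nu) (hU : IsClosed UU) (hX : IsCompact X) :
    IsCompact (trajectorySet A B UU X) := by
  have hcomp : IsCompact ((Set.univ.pi fun _ : ℕ => X) ×ˢ
      (Set.univ.pi fun _ : ℕ => steeringControls A B X)) :=
    (isCompact_univ_pi fun _ => hX).prod
      (isCompact_univ_pi fun _ => isCompact_steeringControls hB hX)
  refine hcomp.of_isClosed_subset ?_ ?_
  · have heq : trajectorySet A B UU X =
        ((⋂ k, {p | p.1 (k + 1) = A *ᵥ p.1 k + B *ᵥ p.2 k}) ∩ ⋂ k, {p | p.1 k ∈ X}) ∩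
          ⋂ k, {p | p.2 k ∈ UU} := by
      ext p
      simp only [trajectorySet, Set.mem_inter_iff, Set.mem_iInter, Set.mem_ofPred_eq]
      exact ⟨fun h => ⟨⟨h.step, h.state_mem⟩, h.control_mem⟩,
        fun h => ⟨rfl, h.1.1, h.1.2, h.2⟩⟩
    rw [heq]
    refine ((isClosed_iInter fun k => ?_).inter (isClosed_iInter fun k => ?_)).inter
      (isClosed_iInter fun k => ?_)
    · exact isClosed_eq (by fun_prop) (by fun_prop)
    · exact hX.isClosed.preimage (by fun_prop)
    · exact hU.preimage (by fun_prop)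
  · rintro p (hp : IsTrajectory A B UU X (p.1 0) p.1 p.2)
    exact ⟨fun k _ => hp.state_mem k, fun k _ =>
      ⟨p.1 k, hp.state_mem k, hp.step k ▸ hp.state_mem (k + 1)⟩⟩

lemma StageCostAssumption.continuous (hL : StageCostAssumption L) : Continuous L :=
  continuousOn_univ.1 (hL.convex.continuousOn isOpen_univ)

lemma lowerSemicontinuous_trajectoryCost (hL : Continuous L) :
    LowerSemicontinuous (trajectoryCost L) :=
  lowerSemicontinuous_tsum fun k =>
    (ENNReal.continuous_ofReal.comp (by fun_prop :
      Continuous fun p : (ℕ → Fin nx → ℝ) × (ℕ → Fin nu → ℝ) =>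
        L (p.1 k, p.2 k))).lowerSemicontinuous

lemma infiniteHorizonCost_le {x₀ : Fin nx → ℝ} {x : ℕ → Fin nx → ℝ} {u : ℕ → Fin nu → ℝ}
    (h : IsTrajectory A B UU X x₀ x u) :
    infiniteHorizonCost A B UU L X x₀ ≤ trajectoryCost L (x, u) :=
  iInf_le_of_le x (iInf_le_of_le u (iInf_le_of_le h le_rfl))

lemma infiniteHorizonCost_eq_top_of_notMem {x₀ : Fin nx → ℝ} (h : x₀ ∉ X) :
    infiniteHorizonCost A B UU L X x₀ = ⊤ := by
  simp only [infiniteHorizonCost, iInf_eq_top]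
  intro x u hxu
  exact absurd (hxu.init ▸ hxu.state_mem 0) h

lemma exists_trajectoryCost_eq (hB : B.rank = nu) (hU : IsClosed UU) (hX : IsCompact X)
    (hL : Continuous L) {x₀ : Fin nx → ℝ} (h : infiniteHorizonCost A B UU L X x₀ ≠ ⊤) :
    ∃ x u, IsTrajectory A B UU X x₀ x u ∧
      trajectoryCost L (x, u) = infiniteHorizonCost A B UU L X x₀ := by
  set T := trajectorySet A B UU X ∩ {p | p.1 0 = x₀} with hT
  have hTc : IsCompact T := (isCompact_trajectorySet hB hU hX).inter_right
    (isClosed_eq (by fun_prop) (by fun_prop))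
  have hTn : T.Nonempty := by
    by_contra hne
    refine h ?_
    simp only [infiniteHorizonCost, iInf_eq_top]
    intro x u hxu
    refine absurd ⟨(x, u), ?_, hxu.init⟩ hne
    exact ⟨rfl, hxu.step, hxu.state_mem, hxu.control_mem⟩
  obtain ⟨p, ⟨hp, hp0⟩, hmin⟩ := LowerSemicontinuousOn.exists_isMinOn hTn hTc
    ((lowerSemicontinuous_trajectoryCost hL).lowerSemicontinuousOn T)
  have hp' : IsTrajectory A B UU X x₀ p.1 p.2 := 
    ⟨hp0, IsTrajectory.step hp, IsTrajectory.state_mem hp, IsTrajectory.control_mem hp⟩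
  refine ⟨p.1, p.2, hp', le_antisymm ?_ (infiniteHorizonCost_le hp')⟩
  refine le_iInf fun x => le_iInf fun u => le_iInf fun hxu => ?_
  exact hmin (show (x, u) ∈ T from ⟨⟨rfl, hxu.step, hxu.state_mem, hxu.control_mem⟩, hxu.init⟩)

/-- As optimal trajectories exist, a sublevel set at a finite level is the image, under the initial
state, of a compact set of trajectories. -/
lemma lowerSemicontinuous_infiniteHorizonCost (hB : B.rank = nu) (hU : IsClosed UU)
    (hX : IsCompact X) (hL : Continuous L) :
    LowerSemicontinuous (infiniteHorizonCost A B UU L X) := by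
  rw [lowerSemicontinuous_iff_isClosed_preimage]
  intro c
  rcases eq_or_ne c ⊤ with rfl | hc
  · simp
  have hcomp : IsCompact ((fun p : (ℕ → Fin nx → ℝ) × (ℕ → Fin nu → ℝ) => p.1 0) ''
      (trajectorySet A B UU X ∩ trajectoryCost L ⁻¹' Set.Iic c)) :=
    ((isCompact_trajectorySet hB hU hX).inter_right
      ((lowerSemicontinuous_trajectoryCost hL).isClosed_preimage c)).image (by fun_prop)
  convert hcomp.isClosed using 1
  ext x₀
  constructor
  · intro (hx : infiniteHorizonCost A B UU L X x₀ ≤ c)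
    obtain ⟨x, u, hxu, heq⟩ := exists_trajectoryCost_eq hB hU hX hL (ne_top_of_le_ne_top hc hx)
    exact ⟨(x, u), ⟨⟨rfl, hxu.step, hxu.state_mem, hxu.control_mem⟩, heq.trans_le hx⟩, hxu.init⟩
  · rintro ⟨p, ⟨hp, hpc⟩, rfl⟩
    exact (infiniteHorizonCost_le hp).trans hpc

/-- The infinite-horizon cost is convex. -/
lemma infiniteHorizonCost_combo_le (hB : B.rank = nu) (hU : IsClosed UU) (hUc : Convex ℝ UU)
    (hX : IsCompact X) (hXc : Convex ℝ X) (hL : StageCostAssumption L) {x y : Fin nx → ℝ} {a b : ℝ}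
    (hx : infiniteHorizonCost A B UU L X x ≠ ⊤) (hy : infiniteHorizonCost A B UU L X y ≠ ⊤)
    (ha : 0 ≤ a) (hb : 0 ≤ b) (hab : a + b = 1) :
    infiniteHorizonCost A B UU L X (a • x + b • y) ≤
      ENNReal.ofReal a * infiniteHorizonCost A B UU L X x +
        ENNReal.ofReal b * infiniteHorizonCost A B UU L X y := by
  obtain ⟨ξ, v, hξ, h1⟩ := exists_trajectoryCost_eq hB hU hX hL.continuous hx
  obtain ⟨η, w, hη, h2⟩ := exists_trajectoryCost_eq hB hU hX hL.continuous hy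
  have htr : IsTrajectory A B UU X (a • x + b • y) (a • ξ + b • η) (a • v + b • w) := by
    refine ⟨by simp [hξ.init, hη.init], fun k => ?_,
      fun k => hXc (hξ.state_mem k) (hη.state_mem k) ha hb hab,
      fun k => hUc (hξ.control_mem k) (hη.control_mem k) ha hb hab⟩
    simp only [Pi.add_apply, Pi.smul_apply, hξ.step, hη.step, Matrix.mulVec_add,
      Matrix.mulVec_smul, smul_add]
    abel
  refine (infiniteHorizonCost_le htr).trans ?_
  rw [← h1, ← h2]
  simp only [trajectoryCost]
  rw [← ENNReal.tsum_mul_left, ← ENNReal.tsum_mul_left, ← ENNReal.tsum_add]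
  refine ENNReal.tsum_le_tsum fun k => ?_
  rw [← ENNReal.ofReal_mul ha, ← ENNReal.ofReal_mul hb,
    ← ENNReal.ofReal_add (mul_nonneg ha (hL.nonneg _)) (mul_nonneg hb (hL.nonneg _))]
  exact ENNReal.ofReal_le_ofReal
    (hL.convex.2 (Set.mem_univ (ξ k, v k)) (Set.mem_univ (η k, w k)) ha hb hab)

/-- On a `lam`-contractive set with `lam < 1` the infinite-horizon cost is bounded. -/
lemma exists_infiniteHorizonCost_le (hsys : SystemAssumption B XX UU) (hL : StageCostAssumption L)
    (hlam0 : 0 ≤ lam) (hlam1 : lam < 1) (hX : IsControlInvariant A B XX UU lam X) :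
    ∃ c : ℝ≥0∞, c ≠ ⊤ ∧ ∀ x ∈ X, infiniteHorizonCost A B UU L X x ≤ c := by
  have hsub : ∀ t : ℝ, 0 ≤ t → t ≤ 1 → ∀ y ∈ X, t • y ∈ X := fun t h0 h1 y hy =>
    hX.convex.smul_mem_of_zero_mem hX.zero_mem hy ⟨h0, h1⟩
  have hsubU : ∀ t : ℝ, 0 ≤ t → t ≤ 1 → ∀ y ∈ UU, t • y ∈ UU := fun t h0 h1 y hy =>
    hsys.control_convex.smul_mem_of_zero_mem hsys.control_zero hy ⟨h0, h1⟩
  -- `c` bounds the stage cost over all states of `X` and all controls that steer within `X`.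
  obtain ⟨c, hc⟩ := (hX.compact.prod
    (isCompact_steeringControls (A := A) hsys.rank_eq hX.compact)).bddAbove_image
    hL.continuous.continuousOn
  have hstep : ∀ x : X, ∃ (u : Fin nu → ℝ) (y : X), u ∈ UU ∧ L (x, u) ≤ c ∧
      A *ᵥ (x : Fin nx → ℝ) + B *ᵥ u = lam • (y : Fin nx → ℝ) := by
    rintro ⟨x, hx⟩
    obtain ⟨u, hu, y, hy, hxy⟩ := hX.contractive x hx
    refine ⟨u, ⟨y, hy⟩, hu, hc ⟨(x, u), ⟨hx, x, hx, ?_⟩, rfl⟩, hxy.symm⟩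
    rw [← hxy]
    exact hsub lam hlam0 hlam1.le y hy
  choose κ nxt hκ hκc hnext using hstep
  refine ⟨ENNReal.ofReal c * (1 - ENNReal.ofReal lam)⁻¹,
    ENNReal.mul_ne_top ENNReal.ofReal_ne_top (ENNReal.inv_ne_top.2
      (tsub_pos_of_lt (by simpa using hlam1)).ne'), fun x hx => ?_⟩
  set y : ℕ → X := fun k => nxt^[k] ⟨x, hx⟩ with hy
  have hp : ∀ k, 0 ≤ lam ^ k ∧ lam ^ k ≤ 1 := fun k =>
    ⟨pow_nonneg hlam0 k, pow_le_one₀ hlam0 hlam1.le⟩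
  -- The factor `lam` gained at each step is pulled out by linearity; the unscaled states `y k` stay
  -- in `X`.
  have htr : IsTrajectory A B UU X x (fun k => lam ^ k • (y k : Fin nx → ℝ))
      (fun k => lam ^ k • κ (y k)) := by
    refine ⟨by simp [hy], fun k => ?_, fun k => hsub _ (hp k).1 (hp k).2 _ (y k).2,
      fun k => hsubU _ (hp k).1 (hp k).2 _ (hκ _)⟩
    rw [Matrix.mulVec_smul, Matrix.mulVec_smul, ← smul_add, hnext, smul_smul, ← pow_succ]
    simp only [hy, Function.iterate_succ_apply']
  refine (infiniteHorizonCost_le htr).trans ?_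
  rw [← ENNReal.tsum_geometric, ← ENNReal.tsum_mul_left]
  refine ENNReal.tsum_le_tsum fun k => ?_
  rw [← ENNReal.ofReal_pow hlam0, mul_comm, ← ENNReal.ofReal_mul (hp k).1]
  refine ENNReal.ofReal_le_ofReal ?_
  -- Convexity between `0` and the unscaled pair, with `L 0 = 0`, gives stage cost at most `lam ^ k
  -- * c`.
  have hcv := hL.convex.2 (Set.mem_univ ((y k : Fin nx → ℝ), κ (y k))) (Set.mem_univ 0)
    (hp k).1 (sub_nonneg.2 (hp k).2) (by ring)
  have hz : L 0 = 0 := hL.zero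
  simp only [smul_zero, add_zero, hz, smul_eq_mul, mul_zero] at hcv
  exact hcv.trans (mul_le_mul_of_nonneg_left (hκc _) (hp k).1)

end Trajectories

/-! ### Attainment of the minimum over the controls. -/

section BellmanTerm

variable {nx nu : ℕ} {A : Matrix (Fin nx) (Fin nx) ℝ} {B : Matrix (Fin nx) (Fin nu) ℝ}
  {XX : Set (Fin nx → ℝ)} {UU : Set (Fin nu → ℝ)} {L : (Fin nx → ℝ) × (Fin nu → ℝ) → ℝ}
  {lam : ℝ} {X : Set (Fin nx → ℝ)}

lemma bellmanTerm_of_mem (hL : ∀ p, 0 ≤ L p) {S : Set (Fin nx → ℝ)} (V : (Fin nx → ℝ) → ℝ≥0∞)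
    {x : Fin nx → ℝ} (hx : x ∈ S) (u : Fin nu → ℝ) :
    bellmanTerm A B S L (fun y => (V y : EReal)) x u =
      ((ENNReal.ofReal (L (x, u)) + V (A *ᵥ x + B *ᵥ u) : ℝ≥0∞) : EReal) := by
  simp [bellmanTerm, convIndicator, hx, hL]

lemma bellmanTerm_of_notMem {S : Set (Fin nx → ℝ)} (V : (Fin nx → ℝ) → ℝ≥0∞)
    {x : Fin nx → ℝ} (hx : x ∉ S) (u : Fin nu → ℝ) :
    bellmanTerm A B S L (fun y => (V y : EReal)) x u = ⊤ := by
  simp only [bellmanTerm, convIndicator, hx, if_false, EReal.coe_add_top]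
  exact EReal.top_add_of_ne_bot (EReal.coe_ennreal_ne_bot _)

/-- The minimum over the controls is attained for lower semicontinuous costs-to-go of compact
domain. -/
lemma exists_isLeast_bellmanTerm (hsys : SystemAssumption B XX UU) (hL : StageCostAssumption L)
    (hX : IsCompact X) {V : (Fin nx → ℝ) → ℝ≥0∞} (hV : LowerSemicontinuous V)
    (hVX : ∀ x ∉ X, V x = ⊤) (x : Fin nx → ℝ) :
    ∃ m, IsLeast (bellmanTerm A B XX L (fun y => (V y : EReal)) x '' UU) m := by
  by_cases htop : ∀ u ∈ UU, bellmanTerm A B XX L (fun y => (V y : EReal)) x u = ⊤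
  · refine ⟨⊤, ⟨0, hsys.control_zero, htop 0 hsys.control_zero⟩, ?_⟩
    rintro _ ⟨u, hu, rfl⟩
    exact (htop u hu).ge
  have hx : x ∈ XX := by
    by_contra hx
    exact htop fun u _ => bellmanTerm_of_notMem V hx u
  set K : Set (Fin nu → ℝ) := {u | u ∈ UU ∧ A *ᵥ x + B *ᵥ u ∈ X} with hK
  have hout : ∀ u ∈ UU, u ∉ K → bellmanTerm A B XX L (fun y => (V y : EReal)) x u = ⊤ := by
    intro u hu huK
    rw [bellmanTerm_of_mem hL.nonneg V hx, hVX _ fun h => huK ⟨hu, h⟩]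
    simp
  have hKc : IsCompact K := by
    have h1 : IsCompact ((fun y => y - A *ᵥ x) '' X) := hX.image (by fun_prop)
    convert ((isClosedEmbedding_mulVec_of_rank_eq hsys.rank_eq).isCompact_preimage h1).inter_left
      hsys.control_closed using 1
    ext u
    simp only [hK, Set.mem_ofPred_eq, Set.mem_inter_iff, Set.mem_preimage, Set.mem_image,
      sub_eq_iff_eq_add', exists_eq_right]
  have hKn : K.Nonempty := by
    by_contra hne
    exact htop fun u hu => hout u hu fun h => hne ⟨u, h⟩
  have hlsc : LowerSemicontinuous fun u =>
      ENNReal.ofReal (L (x, u)) + V (A *ᵥ x + B *ᵥ u) := by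
    have hc := hL.continuous
    refine LowerSemicontinuous.add (Continuous.lowerSemicontinuous
      (ENNReal.continuous_ofReal.comp (by fun_prop : Continuous fun u => L (x, u)))) ?_
    exact hV.comp (g := fun u => A *ᵥ x + B *ᵥ u) (by fun_prop)
  obtain ⟨u, hu, hmin⟩ :=
    LowerSemicontinuousOn.exists_isMinOn hKn hKc (hlsc.lowerSemicontinuousOn K)
  refine ⟨_, ⟨u, hu.1, rfl⟩, ?_⟩
  rintro _ ⟨w, hw, rfl⟩
  by_cases hwK : w ∈ K
  · rw [bellmanTerm_of_mem hL.nonneg V hx, bellmanTerm_of_mem hL.nonneg V hx]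
    exact EReal.coe_ennreal_le_coe_ennreal_iff.2 (hmin hwK)
  · rw [hout w hw hwK]
    exact le_top

end BellmanTerm

/-! ### Bellman's principle and the comparison argument. -/

section DynamicProgramming

variable {nx nu : ℕ} {A : Matrix (Fin nx) (Fin nx) ℝ} {B : Matrix (Fin nx) (Fin nu) ℝ}
  {XX : Set (Fin nx → ℝ)} {UU : Set (Fin nu → ℝ)} {L : (Fin nx → ℝ) × (Fin nu → ℝ) → ℝ}
  {lam : ℝ} {X : Set (Fin nx → ℝ)}

/-- Prepending `(x, u)` to a trajectory from the successor state is admissible. -/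
lemma infiniteHorizonCost_le_stage_add {x : Fin nx → ℝ} (hx : x ∈ X) {u : Fin nu → ℝ}
    (hu : u ∈ UU) :
    infiniteHorizonCost A B UU L X x ≤
      ENNReal.ofReal (L (x, u)) + infiniteHorizonCost A B UU L X (A *ᵥ x + B *ᵥ u) := by
  conv_rhs => rw [infiniteHorizonCost]
  simp only [ENNReal.add_iInf]
  refine le_iInf fun ξ => le_iInf fun v => le_iInf fun hξ => ?_
  have htr : IsTrajectory A B UU X x (fun k => Nat.casesOn k x ξ)
      (fun k => Nat.casesOn k u v) := by
    refine ⟨rfl, fun k => ?_, fun k => ?_, fun k => ?_⟩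
    · cases k with
      | zero => exact hξ.init
      | succ k => exact hξ.step k
    · cases k with
      | zero => exact hx
      | succ k => exact hξ.state_mem k
    · cases k with
      | zero => exact hu
      | succ k => exact hξ.control_mem k
  refine (infiniteHorizonCost_le htr).trans_eq ?_
  rw [trajectoryCost, tsum_eq_zero_add' ENNReal.summable]
  rfl

/-- The tail of an optimal trajectory is admissible from its second state. -/
lemma exists_stage_add_le_infiniteHorizonCost (hB : B.rank = nu) (hU : IsClosed UU)
    (hX : IsCompact X) (hL : Continuous L) {x : Fin nx → ℝ}
    (h : infiniteHorizonCost A B UU L X x ≠ ⊤) :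
    ∃ u ∈ UU, ENNReal.ofReal (L (x, u)) + infiniteHorizonCost A B UU L X (A *ᵥ x + B *ᵥ u) ≤
      infiniteHorizonCost A B UU L X x := by
  obtain ⟨ξ, v, hξ, hc⟩ := exists_trajectoryCost_eq hB hU hX hL h
  refine ⟨v 0, hξ.control_mem 0, ?_⟩
  have htr : IsTrajectory A B UU X (A *ᵥ x + B *ᵥ v 0) (fun k => ξ (k + 1))
      (fun k => v (k + 1)) :=
    ⟨by rw [← hξ.init]; exact hξ.step 0, fun k => hξ.step (k + 1),
      fun k => hξ.state_mem (k + 1), fun k => hξ.control_mem (k + 1)⟩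
  rw [← hc, trajectoryCost, tsum_eq_zero_add' ENNReal.summable]
  have h0 : ξ 0 = x := hξ.init
  simp only [h0]
  gcongr
  exact infiniteHorizonCost_le htr

lemma satisfiesHJB_infiniteHorizonCost (hsys : SystemAssumption B XX UU)
    (hL : StageCostAssumption L) (hX : IsCompact X)
    (hfin : ∀ x ∈ X, infiniteHorizonCost A B UU L X x ≠ ⊤) :
    SatisfiesHJB A B UU L X fun x => (infiniteHorizonCost A B UU L X x : EReal) := by
  intro x hx
  have hlow : ∀ u ∈ UU, (infiniteHorizonCost A B UU L X x : EReal) ≤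
      bellmanTerm A B X L (fun x => (infiniteHorizonCost A B UU L X x : EReal)) x u := by
    intro u hu
    rw [bellmanTerm_of_mem hL.nonneg _ hx]
    exact EReal.coe_ennreal_le_coe_ennreal_iff.2 (infiniteHorizonCost_le_stage_add hx hu)
  constructor
  · obtain ⟨u, hu, hle⟩ := exists_stage_add_le_infiniteHorizonCost hsys.rank_eq
      hsys.control_closed hX hL.continuous (hfin x hx)
    refine ⟨u, hu, le_antisymm ?_ (hlow u hu)⟩
    rw [bellmanTerm_of_mem hL.nonneg _ hx]
    exact EReal.coe_ennreal_le_coe_ennreal_iff.2 hle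
  · rintro _ ⟨u, hu, rfl⟩
    exact hlow u hu

/-- A function that decreases along some control by at least the stage cost dominates the
infinite-horizon cost. -/
lemma infiniteHorizonCost_le_of_decrease {N : (Fin nx → ℝ) → ℝ≥0∞}
    (hN : ∀ x ∈ X, ∃ u ∈ UU, A *ᵥ x + B *ᵥ u ∈ X ∧
      ENNReal.ofReal (L (x, u)) + N (A *ᵥ x + B *ᵥ u) ≤ N x) {x : Fin nx → ℝ} (hx : x ∈ X) :
    infiniteHorizonCost A B UU L X x ≤ N x := by
  choose! κ hκU hκX hκ using hN
  set ξ : ℕ → Fin nx → ℝ := fun k => (fun y => A *ᵥ y + B *ᵥ κ y)^[k] x with hξ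
  have hsucc : ∀ k, ξ (k + 1) = A *ᵥ ξ k + B *ᵥ κ (ξ k) := fun k => by
    simp only [hξ, Function.iterate_succ_apply']
  have hmem : ∀ k, ξ k ∈ X := by
    intro k
    induction k with
    | zero => exact hx
    | succ k ih => rw [hsucc]; exact hκX _ ih
  have htr : IsTrajectory A B UU X x ξ (fun k => κ (ξ k)) :=
    ⟨rfl, hsucc, hmem, fun k => hκU _ (hmem k)⟩
  refine (infiniteHorizonCost_le htr).trans ?_
  -- Telescoped decrease; dropping the term `N (ξ n)` bounds all partial sums.
  have hsum : ∀ n, ∑ k ∈ Finset.range n, ENNReal.ofReal (L (ξ k, κ (ξ k))) + N (ξ n) ≤ N x := by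
    intro n
    induction n with
    | zero => simp [hξ]
    | succ n ih =>
      refine le_trans ?_ ih
      rw [Finset.sum_range_succ, add_assoc, hsucc]
      gcongr
      exact hκ _ (hmem n)
  rw [trajectoryCost, ENNReal.tsum_eq_iSup_nat]
  exact iSup_le fun n => le_self_add.trans (hsum n)

end DynamicProgramming

/-! ### The infinite-horizon cost as the smallest CLF, and uniqueness. -/

section CLF

variable {nx nu : ℕ} {A : Matrix (Fin nx) (Fin nx) ℝ} {B : Matrix (Fin nx) (Fin nu) ℝ}
  {XX : Set (Fin nx → ℝ)} {UU : Set (Fin nu → ℝ)} {L : (Fin nx → ℝ) × (Fin nu → ℝ) → ℝ}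
  {lam : ℝ} {X : Set (Fin nx → ℝ)}

lemma PosDefFun.nonneg {E : Type*} [Zero E] {M : E → EReal} (hM : PosDefFun M) (x : E) :
    0 ≤ M x := by
  rcases eq_or_ne x 0 with rfl | hx
  · exact hM.1.ge
  · exact (hM.2 x hx).le

lemma infiniteHorizonCost_le_of_mem_clfSet (hL : StageCostAssumption L) (hXX : X ⊆ XX)
    {M : (Fin nx → ℝ) → EReal} (hM : M ∈ clfSet A B XX UU L X) (x : Fin nx → ℝ) :
    (infiniteHorizonCost A B UU L X x : EReal) ≤ M x := by
  obtain ⟨hclf, hdom⟩ := hM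
  have hdom' : ∀ y, y ∈ X ↔ M y < ⊤ := fun y => by rw [← hdom]; rfl
  have hcoe : M = fun y => ((M y).toENNReal : EReal) := by
    ext1 y
    exact (EReal.coe_toENNReal (hclf.posDef.nonneg y)).symm
  by_cases hx : x ∈ X
  swap
  · rw [not_lt_top_iff.1 fun h => hx ((hdom' x).2 h)]
    exact le_top
  rw [hcoe]
  refine EReal.coe_ennreal_le_coe_ennreal_iff.2
    (infiniteHorizonCost_le_of_decrease (N := fun y => (M y).toENNReal) (fun y hy => ?_) hx)
  obtain ⟨m, ⟨⟨u, hu, rfl⟩, -⟩, hle⟩ := hclf.lyapunov y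
  rw [hcoe, bellmanTerm_of_mem hL.nonneg (fun y => (M y).toENNReal) (hXX hy),
    EReal.coe_ennreal_le_coe_ennreal_iff] at hle
  refine ⟨u, hu, ?_, hle⟩
  -- Finiteness of `M y` forces `M` to be finite at the successor, which therefore lies in the
  -- domain `X`.
  have hfin : (M y).toENNReal ≠ ⊤ := EReal.toENNReal_ne_top_iff.2 ((hdom' y).1 hy).ne
  have h2 := ne_top_of_le_ne_top hfin (le_add_self.trans hle)
  exact (hdom' _).2 (lt_top_iff_ne_top.2 (EReal.toENNReal_ne_top_iff.1 h2))

lemma coe_ennreal_le_coe_iff {v : ℝ≥0∞} {r : ℝ} :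
    (v : EReal) ≤ r ↔ v ≠ ⊤ ∧ v.toReal ≤ r := by
  induction v with
  | top => simp
  | coe v =>
    simp only [ne_eq, ENNReal.coe_ne_top, not_false_eq_true, true_and, ENNReal.coe_toReal]
    exact EReal.coe_le_coe_iff

lemma infiniteHorizonCost_toReal_combo_le (hsys : SystemAssumption B XX UU)
    (hX : IsCompact X) (hXc : Convex ℝ X) (hL : StageCostAssumption L) {x y : Fin nx → ℝ} {a b : ℝ}
    (hx : infiniteHorizonCost A B UU L X x ≠ ⊤) (hy : infiniteHorizonCost A B UU L X y ≠ ⊤)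
    (ha : 0 ≤ a) (hb : 0 ≤ b) (hab : a + b = 1) :
    infiniteHorizonCost A B UU L X (a • x + b • y) ≠ ⊤ ∧
    (infiniteHorizonCost A B UU L X (a • x + b • y)).toReal ≤
      a * (infiniteHorizonCost A B UU L X x).toReal +
        b * (infiniteHorizonCost A B UU L X y).toReal := by
  have h := infiniteHorizonCost_combo_le hsys.rank_eq hsys.control_closed hsys.control_convex
    hX hXc hL hx hy ha hb hab
  have h1 := ENNReal.mul_ne_top (ENNReal.ofReal_ne_top (r := a)) hx
  have h2 := ENNReal.mul_ne_top (ENNReal.ofReal_ne_top (r := b)) hy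
  refine ⟨ne_top_of_le_ne_top (ENNReal.add_ne_top.2 ⟨h1, h2⟩) h, ?_⟩
  have h3 := ENNReal.toReal_mono (ENNReal.add_ne_top.2 ⟨h1, h2⟩) h
  rwa [ENNReal.toReal_add h1 h2, ENNReal.toReal_mul, ENNReal.toReal_mul,
    ENNReal.toReal_ofReal ha, ENNReal.toReal_ofReal hb] at h3

lemma convexOn_infiniteHorizonCost (hsys : SystemAssumption B XX UU)
    (hX : IsCompact X) (hXc : Convex ℝ X) (hL : StageCostAssumption L)
    (hfin : ∀ x ∈ X, infiniteHorizonCost A B UU L X x ≠ ⊤) :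
    ConvexOn ℝ X fun x => (infiniteHorizonCost A B UU L X x).toReal :=
  ⟨hXc, fun x hx y hy _ _ ha hb hab =>
    (infiniteHorizonCost_toReal_combo_le hsys hX hXc hL (hfin x hx) (hfin y hy) ha hb hab).2⟩

lemma posDefFun_infiniteHorizonCost (hsys : SystemAssumption B XX UU)
    (hL : StageCostAssumption L) (hpos : PosDefFun L) (hX : IsCompact X)
    (h0 : (0 : Fin nx → ℝ) ∈ X) :
    PosDefFun fun x => (infiniteHorizonCost A B UU L X x : EReal) := by
  constructor
  · have htr : IsTrajectory A B UU X 0 (fun _ => 0) (fun _ => 0) :=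
      ⟨rfl, fun _ => by simp, fun _ => h0, fun _ => hsys.control_zero⟩
    have := infiniteHorizonCost_le (L := L) htr
    simp only [trajectoryCost, hL.zero, ENNReal.ofReal_zero, tsum_zero, nonpos_iff_eq_zero] at this
    simp [this]
  · intro x hx
    rw [EReal.coe_ennreal_pos, pos_iff_ne_zero]
    intro hV
    obtain ⟨u, -, hu⟩ := exists_stage_add_le_infiniteHorizonCost (A := A) (UU := UU)
      hsys.rank_eq hsys.control_closed hX hL.continuous (hV.trans_ne ENNReal.zero_ne_top)
    rw [hV, nonpos_iff_eq_zero, add_eq_zero, ENNReal.ofReal_eq_zero] at hu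
    exact (hpos.2 (x, u) fun h => hx (congrArg Prod.fst h)).not_ge hu.1

lemma effDom_infiniteHorizonCost (hfin : ∀ x ∈ X, infiniteHorizonCost A B UU L X x ≠ ⊤) :
    effDom (fun x => (infiniteHorizonCost A B UU L X x : EReal)) = X := by
  ext x
  simp only [effDom, Set.mem_ofPred_eq, lt_top_iff_ne_top, ne_eq, EReal.coe_ennreal_eq_top_iff]
  exact ⟨fun h => by_contra fun hx => h (infiniteHorizonCost_eq_top_of_notMem hx), hfin x⟩

lemma infiniteHorizonCost_mem_clfSet (hsys : SystemAssumption B XX UU)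
    (hL : StageCostAssumption L) (hpos : PosDefFun L) (hXX : X ⊆ XX) (hX : IsCompact X)
    (hXc : Convex ℝ X) (h0 : (0 : Fin nx → ℝ) ∈ X)
    (hfin : ∀ x ∈ X, infiniteHorizonCost A B UU L X x ≠ ⊤) :
    (fun x => (infiniteHorizonCost A B UU L X x : EReal)) ∈ clfSet A B XX UU L X := by
  have hdom := effDom_infiniteHorizonCost hfin
  have hlsc : LowerSemicontinuous (infiniteHorizonCost A B UU L X) :=
    lowerSemicontinuous_infiniteHorizonCost hsys.rank_eq hsys.control_closed hX hL.continuous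
  refine ⟨⟨posDefFun_infiniteHorizonCost hsys hL hpos hX h0, ⟨fun x => EReal.coe_ennreal_ne_bot _,
    hdom.symm ▸ ⟨0, h0⟩, hdom.symm ▸ hX, ?_, ?_⟩, fun x => ?_⟩, hdom⟩
  · have h : LowerSemicontinuous fun x => (infiniteHorizonCost A B UU L X x : EReal) :=
      continuous_coe_ennreal_ereal.comp_lowerSemicontinuous hlsc
        EReal.coe_ennreal_strictMono.monotone
    exact h.isClosed_epigraph.preimage (f := fun p : (Fin nx → ℝ) × ℝ => (p.1, (p.2 : EReal)))
      (continuous_fst.prodMk (continuous_coe_real_ereal.comp continuous_snd))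
  · rintro ⟨x, r⟩ hx ⟨y, s⟩ hy a b ha hb hab
    simp only [epigraph, Set.mem_ofPred_eq, coe_ennreal_le_coe_iff] at hx hy
    have h := infiniteHorizonCost_toReal_combo_le hsys hX hXc hL hx.1 hy.1 ha hb hab
    refine coe_ennreal_le_coe_iff.2 ⟨h.1, h.2.trans ?_⟩
    exact add_le_add (mul_le_mul_of_nonneg_left hx.2 ha) (mul_le_mul_of_nonneg_left hy.2 hb)
  · obtain ⟨m, hm⟩ := exists_isLeast_bellmanTerm (A := A) hsys hL hX hlsc
      (fun x hx => infiniteHorizonCost_eq_top_of_notMem hx) x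
    refine ⟨m, hm, ?_⟩
    by_cases hx : x ∈ X
    -- The Lyapunov inequality uses the indicator of `XX`, the HJB equation that of `X`; both vanish
    -- at `x ∈ X`.
    · obtain ⟨u, hu, hux⟩ := (satisfiesHJB_infiniteHorizonCost hsys hL hX hfin x hx).1
      rw [bellmanTerm_of_mem hL.nonneg _ hx, ← bellmanTerm_of_mem hL.nonneg _ (hXX hx)] at hux
      exact (hm.2 ⟨u, hu, rfl⟩).trans_eq hux
    · rw [infiniteHorizonCost_eq_top_of_notMem hx]
      exact le_top

lemma lowerSemicontinuous_of_isClosed_epigraph {E : Type*} [TopologicalSpace E] {M : E → EReal}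
    (hM : IsClosed (epigraph M)) (hbot : ∀ x, M x ≠ ⊥) : LowerSemicontinuous M := by
  rw [lowerSemicontinuous_iff_isClosed_preimage]
  intro c
  induction c with
  | bot =>
    convert isClosed_empty
    ext x
    simp [hbot x]
  | top => simp
  | coe c => exact hM.preimage (f := fun x => (x, c)) (by fun_prop)

/-- A minimizer of the objective agrees with any pointwise smaller feasible convex function. -/
lemma le_of_clfObjective_le {μ : Measure (Fin nx → ℝ)} (hμ : μ.support = X)
    (hX : IsClosed X) (h0 : (0 : Fin nx → ℝ) ∈ X) {V : (Fin nx → ℝ) → ℝ≥0∞}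
    (hV : ConvexOn ℝ X fun x => (V x).toReal) (hVfin : ∀ x ∈ X, V x ≠ ⊤)
    {M : (Fin nx → ℝ) → EReal} (hM : IsProperCompactConvex M) (hVM : ∀ x, (V x : EReal) ≤ M x)
    (hfin : clfObjective X μ (fun x => (V x : EReal)) ≠ ⊤)
    (hle : clfObjective X μ M ≤ clfObjective X μ fun x => (V x : EReal)) :
    ∀ x ∈ X, M x ≤ V x := by
  have hMmeas : Measurable fun x => (M x).toENNReal :=
    (lowerSemicontinuous_of_isClosed_epigraph hM.epi_closed hM.ne_bot).measurable.ereal_toENNReal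
  -- `V ≤ M` together with `∫ M ≤ ∫ V < ∞` forces equality almost everywhere.
  have hae : (fun x => ((V x : EReal)).toENNReal) =ᵐ[μ.restrict X] fun x => (M x).toENNReal :=
    ae_eq_of_ae_le_of_lintegral_le
      (Eventually.of_forall fun x => EReal.toENNReal_le_toENNReal (hVM x)) hfin
      hMmeas.aemeasurable hle
  rw [Filter.EventuallyEq, ae_restrict_iff' hX.measurableSet] at hae
  have hXae : ∀ᵐ x ∂μ, x ∈ X := hμ ▸ Measure.support_mem_ae
  set D : Set (Fin nx → ℝ) := {x | x ∈ X ∧ M x = V x} with hD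
  have hDae : ∀ᵐ x ∂μ, x ∈ D := by
    filter_upwards [hae, hXae] with x h1 hx
    refine ⟨hx, ?_⟩
    have h2 := h1 hx
    rw [EReal.toENNReal_coe] at h2
    rw [h2, EReal.coe_toENNReal ((EReal.coe_ennreal_nonneg _).trans (hVM x))]
  -- A closed set of full measure contains the support.
  have hXD : X ⊆ closure D := by
    rw [← hμ]
    exact Measure.support_subset_of_isClosed isClosed_closure
      (Filter.mem_of_superset hDae subset_closure)
  intro x hx
  have hcoe : ∀ y ∈ X, ((V y).toReal : EReal) = V y := fun y hy =>
    EReal.coe_ennreal_toReal (hVfin y hy)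
  have := graph_mem_of_dense (C := epigraph M) h0 hV hM.epi_closed
    (fun y r s hr hrs => le_trans (show M y ≤ r from hr) (EReal.coe_le_coe_iff.2 hrs))
    (fun d hd => hd.1) hXD (fun d hd => (hd.2.trans (hcoe d hd.1).symm).le) x hx
  exact (show M x ≤ ((V x).toReal : EReal) from this).trans_eq (hcoe x hx)

end CLF

/-! ### Existence, uniqueness and characterization of the minimizer. -/

theorem mainTheorem3 {nx nu : ℕ} (A : Matrix (Fin nx) (Fin nx) ℝ)
    (B : Matrix (Fin nx) (Fin nu) ℝ) (XX : Set (Fin nx → ℝ)) (UU : Set (Fin nu → ℝ))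
    (L : (Fin nx → ℝ) × (Fin nu → ℝ) → ℝ)
    (hsys : SystemAssumption B XX UU) (hcost : StageCostAssumption L) (hL : PosDefFun L)
    (lam : ℝ) (hlam0 : 0 ≤ lam) (hlam1 : lam < 1)
    (X : Set (Fin nx → ℝ)) (hX : IsControlInvariant A B XX UU lam X)
    (μ : Measure (Fin nx → ℝ)) [IsProbabilityMeasure μ] (hμ : μ.support = X) :
    ∃ Mstar : (Fin nx → ℝ) → EReal,
      (Mstar ∈ clfSet A B XX UU L X ∧ IsMinOn (clfObjective X μ) (clfSet A B XX UU L X) Mstar) ∧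
      (∀ M : (Fin nx → ℝ) → EReal,
        M ∈ clfSet A B XX UU L X ∧ IsMinOn (clfObjective X μ) (clfSet A B XX UU L X) M →
          M = Mstar) ∧
      clfObjective X μ Mstar ≠ ⊤ ∧
      (∀ x, Mstar x = (infiniteHorizonCost A B UU L X x : EReal)) ∧
      SatisfiesHJB A B UU L X Mstar := by
  obtain ⟨c, hc, hbound⟩ := exists_infiniteHorizonCost_le hsys hcost hlam0 hlam1 hX
  have hfin : ∀ x ∈ X, infiniteHorizonCost A B UU L X x ≠ ⊤ := fun x hx =>
    ne_top_of_le_ne_top hc (hbound x hx)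
  have hmem := infiniteHorizonCost_mem_clfSet hsys hcost hL hX.subset_state hX.compact hX.convex
    hX.zero_mem hfin
  have hle : ∀ M ∈ clfSet A B XX UU L X, ∀ x,
      (infiniteHorizonCost A B UU L X x : EReal) ≤ M x := fun M hM =>
    infiniteHorizonCost_le_of_mem_clfSet hcost hX.subset_state hM
  have hobj : clfObjective X μ (fun x => (infiniteHorizonCost A B UU L X x : EReal)) ≠ ⊤ := by
    have hXm : MeasurableSet X := hX.compact.isClosed.measurableSet
    refine ne_top_of_le_ne_top (ENNReal.mul_ne_top hc (measure_ne_top μ X)) ?_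
    rw [← setLIntegral_const]
    exact setLIntegral_mono measurable_const fun x hx => by
      simpa using hbound x hx
  refine ⟨fun x => (infiniteHorizonCost A B UU L X x : EReal), ⟨hmem, fun M hM => ?_⟩, ?_, hobj,
    fun _ => rfl, satisfiesHJB_infiniteHorizonCost hsys hcost hX.compact hfin⟩
  · exact lintegral_mono fun x => EReal.toENNReal_le_toENNReal (hle M hM x)
  · rintro M ⟨hM, hmin⟩
    ext1 x
    refine le_antisymm ?_ (hle M hM x)
    by_cases hx : x ∈ X
    · exact le_of_clfObjective_le hμ hX.compact.isClosed hX.zero_mem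
        (convexOn_infiniteHorizonCost hsys hX.compact hX.convex hcost hfin) hfin
        hM.1.properCompactConvex (hle M hM) hobj (hmin hmem) x hx
    · rw [infiniteHorizonCost_eq_top_of_notMem hx]
      exact le_top
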